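/- Let $G=(V,E)$ be a finite simple graph. A complex (real) realisation of $G$ is a map $p$ from $V$ to $\mathbb{C}^2$ (to $\mathbb{R}^2$), and $(G,p)$ is then called a framework; it is generic if the $2|V|$ coordinates of the points $p(w)$, $w\in V$, are algebraically independent over $\mathbb{Q}$. For $P=(x,y)$ put $d(P)=x^2+y^2$. Frameworks $(G,p)$ and $(G,q)$ are equivalent if $d(p(a)-p(b))=d(q(a)-q(b))$ for all $ab\in E$, and congruent if this holds for all $a,b\in V$. A real framework $(G,p)$ is rigid if there is $\varepsilon>0$ such that every real framework $(G,q)$ that is equivalent to $(G,p)$ and satisfies $d(p(w)-q(w))<\varepsilon$ for all $w\in V$ is congruent to $(G,p)$; the graph $G$ is rigid if some (equivalently, every) generic real realisation of $G$ is rigid. For a complex framework $(G,p)$ and $u,v\in V$, the pair $\{u,v\}$ is globally linked in $(G,p)$ if every complex realisation $(G,q)$ equivalent to $(G,p)$ satisfies $d(p(u)-p(v))=d(q(u)-q(v))$. Theorem. Let $(G,p)$ be a generic complex realisation of a finite simple graph $G=(V,E)$. Let $v_n\in V$ be a vertex whose set of neighbours is $N(v_n)=\{v_1,v_2,v_3\}$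 with $v_1,v_2,v_3$ distinct, and let $u,v\in V\setminus\{v_n\}$. Let $H=G-v_n+v_1v_2$ be the graph obtained from $G$ by deleting $v_n$ and adding the edge $v_1v_2$ (if it is not already present). Suppose that $G-v_n$ is rigid and that $\{u,v\}$ is globally linked in $(H,p|_{V\setminus\{v_n\}})$. Then $\{u,v\}$ is globally linked in $(G,p)$. -/

import Mathlib

namespace PlaneFramework

/-- The quadratic form `d(x, y) = x² + y²` on `K²` (with no complex conjugation when `K = ℂ`). -/
def d {K : Type*} [CommRing K] (P : Fin 2 → K) : K :=
  P 0 ^ 2 + P 1 ^ 2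

/-- The frameworks `(G, p)` and `(G, q)` are equivalent: corresponding edges have equal
squared lengths. -/
def Equivalent {V K : Type*} [CommRing K] (G : SimpleGraph V) (p q : V → Fin 2 → K) : Prop :=
  ∀ u v : V, G.Adj u v → d (p u - p v) = d (q u - q v)

/-- The realisations `p` and `q` are congruent: all pairs of corresponding points have equal
squared distances. -/
def Congruent {V K : Type*} [CommRing K] (p q : V → Fin 2 → K) : Prop :=
  ∀ u v : V, d (p u - p v) = d (q u - q v)

/-- A realisation is generic if its coordinates (as a family indexed by vertex and coordinate)
are algebraically independent over `ℚ`. -/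
def Generic {V K : Type*} [Field K] [Algebra ℚ K] (p : V → Fin 2 → K) : Prop :=
  AlgebraicIndependent ℚ (fun i : V × Fin 2 => p i.1 i.2)

/-- A real framework is rigid if every equivalent real framework that is sufficiently close to it
is congruent to it. -/
def RigidFramework {V : Type*} (G : SimpleGraph V) (p : V → Fin 2 → ℝ) : Prop :=
  ∃ ε : ℝ, 0 < ε ∧ ∀ q : V → Fin 2 → ℝ,
    Equivalent G p q → (∀ v : V, d (p v - q v) < ε) → Congruent p q

/-- A graph is rigid (in the plane) if some generic real realisation of it is rigid.
Rigidity is a generic property, so for finite graphs "some" may be replaced by "every";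
"some" is the formally weaker of the two conditions. -/
def RigidGraph {V : Type*} (G : SimpleGraph V) : Prop :=
  ∃ p : V → Fin 2 → ℝ, Generic p ∧ RigidFramework G p

/-- The pair `{u, v}` is globally linked in the complex framework `(G, p)`. -/
def GloballyLinked {V : Type*} (G : SimpleGraph V) (p : V → Fin 2 → ℂ) (u v : V) : Prop :=
  ∀ q : V → Fin 2 → ℂ, Equivalent G p q → d (p u - p v) = d (q u - q v)

end PlaneFramework

/-! It suffices that `d (q v₁ - q v₂) = d (p v₁ - p v₂)` for every `q` equivalent to `p`, since `q`
then restricts to a realisation equivalent to `p` on `H`. As `p` is generic, any velocity on `p`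
comes from a derivation `D` of the field, which also moves `q`. If only the removed vertex `n`
moves, all lengths in `G - n` are killed by `D`; by rigidity `D q` is an infinitesimal isometry away
from `n` (`RigidGraph.exists_infinitesimal_isometry`). Its three edges at `n` then force the linear
relation between the vectors from `p v₁` to `p v₂`, `p v₃`, `p n` to hold for `q` too. With `d (p n
- p v₁) = d (q n - q v₁)` this gives `A² k₁ + 2 A B k₂ + B² k₃ = 0`, where the `kᵢ` are differences
of Gram entries (`gram_relation`). Each `D` kills the `kᵢ` but not the coefficients, so
differentiating twice yields `k₁ = 0`. -/

/-! ### Derivations with prescribed values on algebraically independent elements. -/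

theorem Derivation.exists_extension_of_formallyEtale {k A L : Type*} [CommRing k] [CommRing A]
    [CommRing L] [Algebra k A] [Algebra k L] [Algebra A L] [IsScalarTower k A L]
    [Algebra.FormallyEtale A L] (D : Derivation k A L) :
    ∃ D' : Derivation k L L, ∀ a, D' (algebraMap A L a) = D a := by
  let e := KaehlerDifferential.tensorKaehlerEquivOfFormallyEtale k A L
  let φ : TensorProduct A L (KaehlerDifferential k A) →ₗ[L] L :=
    LinearMap.liftBaseChange L D.liftKaehlerDifferential
  refine ⟨(φ ∘ₗ e.symm.toLinearMap).compDer (KaehlerDifferential.D k L), fun a => ?_⟩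
  have h := KaehlerDifferential.tensorKaehlerEquivOfFormallyEtale_symm_D_algebraMap k A L a
  simp [φ, e, h]

open scoped IntermediateField.algebraAdjoinAdjoin in
-- `L` is formally étale over the polynomial ring on the basis: localise to the rational function
-- field, then take an algebraic extension, separable in characteristic zero.
theorem IsTranscendenceBasis.exists_derivation {k L ι : Type*} [Field k] [CharZero k] [Field L]
    [Algebra k L] {x : ι → L} (hx : IsTranscendenceBasis k x) (f : ι → L) :
    ∃ D : Derivation k L L, ∀ i, D (x i) = f i := by
  let A := Algebra.adjoin k (Set.range x)
  let F := IntermediateField.adjoin k (Set.range x)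
  have : Algebra.IsAlgebraic F L := hx.isAlgebraic_field
  have : Algebra.FormallyEtale A F := .of_isLocalization (nonZeroDivisors A)
  have : Algebra.FormallyEtale F L := .of_isSeparable F L
  have : Algebra.FormallyEtale A L := .comp A F L
  let e : MvPolynomial ι k ≃ₐ[k] A := hx.1.aevalEquiv
  let : Algebra (MvPolynomial ι k) A := e.toAlgHom.toRingHom.toAlgebra
  let : Algebra (MvPolynomial ι k) L := (MvPolynomial.aeval x).toRingHom.toAlgebra
  have : IsScalarTower k (MvPolynomial ι k) L :=
    .of_algebraMap_eq fun a => ((MvPolynomial.aeval x).commutes a).symm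
  have : IsScalarTower (MvPolynomial ι k) A L :=
    .of_algebraMap_eq fun a => (hx.1.algebraMap_aevalEquiv a).symm
  have : Algebra.FormallyEtale (MvPolynomial ι k) A :=
    .of_equiv (AlgEquiv.ofBijective (Algebra.ofId _ _) e.bijective)
  have : Algebra.FormallyEtale (MvPolynomial ι k) L := .comp _ A L
  obtain ⟨D, hD⟩ := (MvPolynomial.mkDerivation k f).exists_extension_of_formallyEtale
  refine ⟨D, fun i => ?_⟩
  have h := hD (MvPolynomial.X i)
  rwa [MvPolynomial.mkDerivation_X, RingHom.algebraMap_toAlgebra, AlgHom.toRingHom_eq_coe,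
    AlgHom.coe_toRingHom, MvPolynomial.aeval_X] at h

theorem AlgebraicIndependent.exists_derivation {k L ι : Type*} [Field k] [CharZero k] [Field L]
    [Algebra k L] {x : ι → L} (hx : AlgebraicIndependent k x) (f : ι → L) :
    ∃ D : Derivation k L L, ∀ i, D (x i) = f i := by
  obtain ⟨s, hs, hs'⟩ := exists_isTranscendenceBasis_superset (s := Set.range x) hx.to_subtype_range
  obtain ⟨D, hD⟩ := hs'.exists_derivation fun i => Function.extend x f 0 i
  refine ⟨D, fun i => ?_⟩
  have h := hD ⟨x i, hs ⟨i, rfl⟩⟩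
  rwa [hx.injective.extend_apply] at h

namespace PlaneFramework

/-! ### Rigidity implies infinitesimal rigidity at generic realisations. -/

/-- Half the differential at `p` of the squared distance between the vertices `a` and `b`. -/
def lengthDeriv {V K : Type*} [CommRing K] (p : V → Fin 2 → K) (a b : V) :
    (V → Fin 2 → K) →ₗ[K] K where
  toFun M := (p a 0 - p b 0) * (M a 0 - M b 0) + (p a 1 - p b 1) * (M a 1 - M b 1)
  map_add' M N := by simp only [Pi.add_apply]; ring
  map_smul' c M := by simp only [Pi.smul_apply, smul_eq_mul, RingHom.id_apply]; ring

theorem lengthDeriv_apply {V K : Type*} [CommRing K] (p M : V → Fin 2 → K) (a b : V) :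
    lengthDeriv p a b M =
      (p a 0 - p b 0) * (M a 0 - M b 0) + (p a 1 - p b 1) * (M a 1 - M b 1) :=
  rfl

theorem map_lengthDeriv {V K L : Type*} [CommRing K] [CommRing L] (φ : K →+* L)
    (p M : V → Fin 2 → K) (a b : V) :
    φ (lengthDeriv p a b M) =
      lengthDeriv (fun v i => φ (p v i)) a b fun v i => φ (M v i) := by
  simp [lengthDeriv_apply]

theorem contDiff_aeval_realisation {V : Type*} [Fintype V] (P : MvPolynomial (V × Fin 2) ℚ) :
    ContDiff ℝ 1 fun z : V → Fin 2 → ℝ =>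
      MvPolynomial.aeval (fun e : V × Fin 2 => z e.1 e.2) P := by
  induction P using MvPolynomial.induction_on with
  | C r => simpa using contDiff_const
  | add P Q hP hQ => simpa using hP.add hQ
  | mul_X P e hP =>
    simp only [map_mul, MvPolynomial.aeval_X]
    exact hP.mul (contDiff_apply_apply ℝ ℝ e.1 e.2)

/-- A smooth field of infinitesimal motions is trivial at every rigid framework. -/
theorem RigidFramework.lengthDeriv_eq_zero {V : Type*} [Fintype V] {G : SimpleGraph V}
    {p : V → Fin 2 → ℝ} (h : RigidFramework G p) {F : (V → Fin 2 → ℝ) → V → Fin 2 → ℝ}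
    (hF : ContDiff ℝ 1 F) (hG : ∀ z a b, G.Adj a b → lengthDeriv z a b (F z) = 0) (a b : V) :
    lengthDeriv p a b (F p) = 0 := by
  obtain ⟨ε, hε, hrig⟩ := h
  -- The integral curve of `F` through `p` preserves edge lengths, so by rigidity it preserves all
  -- distances near time `0`.
  obtain ⟨γ, hγ₀, δ, hδ, hγ⟩ :=
    hF.contDiffAt.exists_forall_mem_closedBall_exists_eq_forall_mem_Ioo_hasDerivAt₀ (x₀ := p) 0
  have hcoord (t : ℝ) (ht : t ∈ Set.Ioo (0 - δ) (0 + δ)) (v : V) (i : Fin 2) :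
      HasDerivAt (fun s => γ s v i) (F (γ t) v i) t :=
    hasDerivAt_pi.1 (hasDerivAt_pi.1 (hγ t ht) v) i
  have hd (t : ℝ) (ht : t ∈ Set.Ioo (0 - δ) (0 + δ)) (a b : V) :
      HasDerivAt (fun s => d (γ s a - γ s b)) (2 * lengthDeriv (γ t) a b (F (γ t))) t := by
    refine (((((hcoord t ht a 0).sub (hcoord t ht b 0)).pow 2).add
      (((hcoord t ht a 1).sub (hcoord t ht b 1)).pow 2))).congr_deriv ?_
    simp [lengthDeriv_apply]
    ring
  have h0 : (0 : ℝ) ∈ Set.Ioo (0 - δ) (0 + δ) := by constructor <;> linarith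
  have hequiv (t : ℝ) (ht : t ∈ Set.Ioo (0 - δ) (0 + δ)) : Equivalent G p (γ t) := by
    intro a b hab
    have := isOpen_Ioo.is_const_of_deriv_eq_zero isPreconnected_Ioo
      (fun s hs => (hd s hs a b).differentiableAt.differentiableWithinAt)
      (fun s hs => by simpa [hG _ a b hab] using (hd s hs a b).deriv) h0 ht
    simpa [hγ₀] using this
  have hclose : ∀ᶠ t in nhds (0 : ℝ), ∀ v, d (p v - γ t v) < ε := by
    refine Filter.eventually_all.2 fun v => ?_
    have hc (i : Fin 2) : ContinuousAt (fun s => γ s v i) 0 := (hcoord 0 h0 v i).continuousAt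
    have : ContinuousAt (fun s => d (p v - γ s v)) 0 :=
      ((continuousAt_const.sub (hc 0)).pow 2).add ((continuousAt_const.sub (hc 1)).pow 2)
    exact this.eventually_lt continuousAt_const (by simpa [hγ₀, d] using hε)
  have hconst : (fun t => d (γ t a - γ t b)) =ᶠ[nhds 0] fun _ => d (p a - p b) := by
    filter_upwards [hclose, isOpen_Ioo.mem_nhds h0] with t ht ht'
    exact (hrig (γ t) (hequiv t ht') ht a b).symm
  have := (hd 0 h0 a b).unique ((hasDerivAt_const (0 : ℝ) _).congr_of_eventuallyEq hconst)
  simpa [hγ₀] using this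

/-- Every infinitesimal motion of a generic realisation of a rigid graph is trivial. -/
theorem RigidGraph.lengthDeriv_eq_zero {V : Type*} [Finite V] {G : SimpleGraph V}
    (h : RigidGraph G) {K : Type*} [Field K] [Algebra ℚ K] {p : V → Fin 2 → K} (hp : Generic p)
    {M : V → Fin 2 → K} (hM : ∀ a b, G.Adj a b → lengthDeriv p a b M = 0) (a b : V) :
    lengthDeriv p a b M = 0 := by
  classical
  cases nonempty_fintype V
  let A := MvPolynomial (V × Fin 2) ℚ
  let F := FractionRing A
  let x : V → Fin 2 → A := fun v i => MvPolynomial.X (v, i)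
  let xF : V → Fin 2 → F := fun v i => algebraMap A F (x v i)
  let r (e : V × V) : Module.Dual F (V → Fin 2 → F) := lengthDeriv xF e.1 e.2
  let R (e : {e : V × V // G.Adj e.1 e.2}) := r e
  -- Otherwise some motion over the rational function field kills every edge row but not `r (a, b)`.
  -- Clearing denominators makes it a polynomial vector field, to which the smooth case applies.
  have hspan : r (a, b) ∈ Submodule.span F (Set.range R) := by
    by_contra hn
    obtain ⟨f, hf, hker⟩ := Submodule.exists_le_ker_of_notMem hn
    obtain ⟨X, rfl⟩ := (Module.evalEquiv F (V → Fin 2 → F)).surjective f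
    obtain ⟨s, hs⟩ := IsLocalization.exist_integer_multiples_of_finite (nonZeroDivisors A)
      fun e : V × Fin 2 => X e.1 e.2
    choose Y hY using hs
    have hYX : (fun v i => algebraMap A F (Y (v, i))) = algebraMap A F s • X := by
      ext v i
      simp [hY, Algebra.smul_def]
    have hr (e : V × V) : algebraMap A F (lengthDeriv x e.1 e.2 fun v i => Y (v, i)) =
        algebraMap A F s * r e X := by
      rw [map_lengthDeriv, hYX, map_smul, smul_eq_mul]
    have hinj := IsFractionRing.injective A F
    obtain ⟨p₀, hp₀, hrig⟩ := h
    have hev (z : V → Fin 2 → ℝ) (a b : V) :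
        MvPolynomial.aeval (fun e : V × Fin 2 => z e.1 e.2)
          (lengthDeriv x a b fun v i => Y (v, i)) =
        lengthDeriv z a b fun v i => MvPolynomial.aeval (fun e : V × Fin 2 => z e.1 e.2)
          (Y (v, i)) := by
      have := map_lengthDeriv (MvPolynomial.aeval (R := ℚ)
        (fun e : V × Fin 2 => z e.1 e.2)).toRingHom x (fun v i => Y (v, i)) a b
      simpa [x] using this
    have h1 := hrig.lengthDeriv_eq_zero
      (F := fun z v i => MvPolynomial.aeval (fun e : V × Fin 2 => z e.1 e.2) (Y (v, i)))
      (contDiff_pi.2 fun v => contDiff_pi.2 fun i => contDiff_aeval_realisation _)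
      (fun z a b hab => by
        rw [← hev]
        have h0 : r (a, b) X = 0 := hker (Submodule.subset_span ⟨⟨(a, b), hab⟩, rfl⟩)
        have h1 := hr (a, b)
        rw [h0, mul_zero, map_eq_zero_iff _ hinj] at h1
        rw [h1, map_zero]) a b
    rw [← hev] at h1
    -- A polynomial vanishing at the generic point `p₀` is zero.
    have h2 := (injective_iff_map_eq_zero _).1 hp₀ _ h1
    have h3 := hr (a, b)
    rw [h2, map_zero, eq_comm, mul_eq_zero, map_eq_zero_iff _ hinj] at h3
    exact h3.elim (nonZeroDivisors.coe_ne_zero s) hf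
  obtain ⟨c, hc⟩ := (Submodule.mem_span_range_iff_exists_fun F).1 hspan
  -- Evaluation at `p` extends to rational functions because `p` is generic; it specialises the row
  -- dependency to `K`.
  let φ : F →+* K := IsFractionRing.lift (g := (MvPolynomial.aeval fun e : V × Fin 2 =>
    p e.1 e.2 : A →ₐ[ℚ] K).toRingHom) hp
  have hφ (v : V) (i : Fin 2) : φ (xF v i) = p v i := by
    exact (IsFractionRing.lift_algebraMap hp _).trans (MvPolynomial.aeval_X _ _)
  have key : lengthDeriv p a b = ∑ e, φ (c e) • lengthDeriv p e.1.1 e.1.2 := by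
    refine LinearMap.pi_ext' fun v => LinearMap.pi_ext' fun i => LinearMap.ext_ring ?_
    have h1 := congr(φ ($hc (Pi.single v (Pi.single i 1))))
    simp only [LinearMap.sum_apply, LinearMap.smul_apply, smul_eq_mul, map_sum, map_mul, R, r,
      map_lengthDeriv, hφ] at h1
    have h2 : (fun w j => φ ((Pi.single v (Pi.single i 1) : V → Fin 2 → F) w j)) =
        Pi.single v (Pi.single i 1) := by
      ext w j
      by_cases hw : w = v
      · subst hw
        by_cases hj : j = i
        · subst hj; simp
        · simp [hj]
      · simp [hw]
    rw [h2] at h1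
    simpa using h1.symm
  rw [key, LinearMap.sum_apply]
  exact Finset.sum_eq_zero fun e _ => by rw [LinearMap.smul_apply, hM _ _ e.2, smul_zero]

/-! ### Derivations and general position at a generic realisation. -/

theorem Generic.exists_derivation {V K : Type*} [Field K] [Algebra ℚ K] {p : V → Fin 2 → K}
    (hp : Generic p) (M : V → Fin 2 → K) :
    ∃ D : Derivation ℚ K K, ∀ v i, D (p v i) = M v i := by
  obtain ⟨D, hD⟩ := AlgebraicIndependent.exists_derivation hp fun e => M e.1 e.2
  exact ⟨D, fun v i => hD (v, i)⟩

theorem Generic.coord_ne {V K : Type*} [Field K] [Algebra ℚ K] {p : V → Fin 2 → K}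
    (hp : Generic p) {a b : V} (hab : a ≠ b) (i : Fin 2) : p a i ≠ p b i := fun h =>
  hab congr(Prod.fst $(AlgebraicIndependent.injective hp (a₁ := (a, i)) (a₂ := (b, i)) h))

/-- Three points of a generic realisation are not collinear. -/
theorem Generic.det_ne_zero {V K : Type*} [Field K] [Algebra ℚ K] {p : V → Fin 2 → K}
    (hp : Generic p) {a b c : V} (hab : a ≠ b) (hac : a ≠ c) (hbc : b ≠ c) :
    (p b 0 - p a 0) * (p c 1 - p a 1) - (p b 1 - p a 1) * (p c 0 - p a 0) ≠ 0 := by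
  classical
  intro h
  -- Moving only the second coordinate of `c` turns the determinant into `p b 0 - p a 0`.
  obtain ⟨D, hD⟩ := hp.exists_derivation (Pi.single c ![0, 1])
  have h1 := congr(D $h)
  simp [hD, hac, hbc, sub_eq_zero] at h1
  exact hp.coord_ne hab 0 h1.symm

theorem derivation_d_sub {V K : Type*} [Field K] [Algebra ℚ K] (D : Derivation ℚ K K)
    (p : V → Fin 2 → K) (a b : V) :
    D (d (p a - p b)) = 2 * lengthDeriv p a b fun v i => D (p v i) := by
  simp [d, Derivation.leibniz_pow, lengthDeriv_apply]
  ring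

/-! ### Infinitesimal motions of equivalent realisations. -/

/-- The rigidity matrix of `(G, p)`, as a linear map. -/
def rigidityMap {V K : Type*} [CommRing K] (G : SimpleGraph V) (p : V → Fin 2 → K) :
    (V → Fin 2 → K) →ₗ[K] ({e : V × V // G.Adj e.1 e.2} → K) :=
  LinearMap.pi fun e => lengthDeriv p e.1.1 e.1.2

theorem mem_ker_rigidityMap {V K : Type*} [CommRing K] {G : SimpleGraph V}
    {p M : V → Fin 2 → K} :
    M ∈ LinearMap.ker (rigidityMap G p) ↔ ∀ a b, G.Adj a b → lengthDeriv p a b M = 0 := by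
  simp [rigidityMap, funext_iff]

/-- A motion preserves all distances to first order, so it vanishes once `a` and one coordinate of
`b` are pinned: every other vertex is off the line through `a` and `b`. -/
theorem RigidGraph.finrank_ker_rigidityMap_le {V : Type*} [Finite V] {G : SimpleGraph V}
    (h : RigidGraph G) {K : Type*} [Field K] [Algebra ℚ K] {p : V → Fin 2 → K} (hp : Generic p)
    {a b : V} (hab : a ≠ b) :
    Module.finrank K (LinearMap.ker (rigidityMap G p)) ≤ 3 := by
  let φ : (V → Fin 2 → K) →ₗ[K] Fin 3 → K :=
    { toFun M := ![M a 0, M a 1, M b 0]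
      map_add' M N := by ext i; fin_cases i <;> rfl
      map_smul' c M := by ext i; fin_cases i <;> rfl }
  have hφ : Function.Injective (φ ∘ₗ (LinearMap.ker (rigidityMap G p)).subtype) := by
    refine (injective_iff_map_eq_zero _).2 fun ⟨M, hM⟩ h0 => Subtype.ext ?_
    have hM' := h.lengthDeriv_eq_zero hp (mem_ker_rigidityMap.1 hM)
    have ha0 : M a 0 = 0 := congr_fun h0 0
    have ha1 : M a 1 = 0 := congr_fun h0 1
    have hb0 : M b 0 = 0 := congr_fun h0 2
    have hb1 : M b 1 = 0 := by
      have := hM' b a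
      rw [lengthDeriv_apply, ha0, ha1, hb0] at this
      simpa [sub_eq_zero, hp.coord_ne hab.symm] using this
    have key (c : V) : M c 0 = 0 ∧ M c 1 = 0 := by
      by_cases hca : c = a
      · subst hca; exact ⟨ha0, ha1⟩
      by_cases hcb : c = b
      · subst hcb; exact ⟨hb0, hb1⟩
      have hdet := hp.det_ne_zero hab (Ne.symm hca) (Ne.symm hcb)
      have h1 := hM' c a
      have h2 := hM' c b
      rw [lengthDeriv_apply, ha0, ha1] at h1
      rw [lengthDeriv_apply, hb0, hb1] at h2
      constructor <;> refine (mul_eq_zero.1 ?_).resolve_left hdet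
      · linear_combination (p c 1 - p b 1) * h1 - (p c 1 - p a 1) * h2
      · linear_combination (p c 0 - p a 0) * h2 - (p c 0 - p b 0) * h1
    ext c i
    fin_cases i
    · exact (key c).1
    · exact (key c).2
  simpa using LinearMap.finrank_le_finrank_of_injective hφ

/-- Every infinitesimal motion of a realisation equivalent to a generic realisation of a rigid
graph is induced by an infinitesimal isometry of the plane. -/
theorem RigidGraph.exists_infinitesimal_isometry {V : Type*} [Finite V] {G : SimpleGraph V}
    (h : RigidGraph G) {K : Type*} [Field K] [Algebra ℚ K] {p q : V → Fin 2 → K} (hp : Generic p)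
    (hpq : Equivalent G p q) {a b : V} (hab : a ≠ b) {M : V → Fin 2 → K}
    (hM : ∀ a b, G.Adj a b → lengthDeriv q a b M = 0) :
    ∃ s t ω : K, ∀ v, M v 0 = s - ω * q v 1 ∧ M v 1 = t + ω * q v 0 := by
  classical
  have : CharZero K := algebraRat.charZero K
  -- Differentiating the equal edge lengths shows that the rank at `q` is at least the rank at `p`.
  have hrange : LinearMap.range (rigidityMap G p) ≤ LinearMap.range (rigidityMap G q) := by
    rintro _ ⟨N, rfl⟩
    obtain ⟨D, hD⟩ := hp.exists_derivation N
    refine ⟨fun v i => D (q v i), funext fun e => ?_⟩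
    have h1 := congr(D $(hpq _ _ e.2))
    simp only [derivation_d_sub, hD] at h1
    exact (mul_left_cancel₀ two_ne_zero h1).symm
  let τ : (Fin 3 → K) →ₗ[K] V → Fin 2 → K :=
    { toFun x v := ![x 0 - x 2 * q v 1, x 1 + x 2 * q v 0]
      map_add' x y := by ext v i; fin_cases i <;> simp <;> ring
      map_smul' c x := by ext v i; fin_cases i <;> simp <;> ring }
  have hτker : LinearMap.range τ ≤ LinearMap.ker (rigidityMap G q) := by
    rintro _ ⟨x, rfl⟩
    refine mem_ker_rigidityMap.2 fun a b _ => ?_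
    simp [lengthDeriv_apply, τ]
    ring
  have hτ : Function.Injective τ := by
    refine (injective_iff_map_eq_zero _).2 fun x hx => ?_
    have hx0 (v : V) : x 0 - x 2 * q v 1 = 0 := congr_fun (congr_fun hx v) 0
    have hx1 (v : V) : x 1 + x 2 * q v 0 = 0 := congr_fun (congr_fun hx v) 1
    -- If not, all points of `q` coincide, so the rigidity map vanishes at `q`, hence at `p`, and
    -- moving `a` alone would be a trivial motion.
    have hx2 : x 2 = 0 := by
      by_contra hne
      have hq0 (u v : V) : q u 0 - q v 0 = 0 :=
        (mul_eq_zero.1 (by linear_combination hx1 u - hx1 v)).resolve_left hne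
      have hq1 (u v : V) : q u 1 - q v 1 = 0 :=
        (mul_eq_zero.1 (by linear_combination hx0 v - hx0 u)).resolve_left hne
      have hRq : rigidityMap G q = 0 := LinearMap.ext fun N => funext fun e => by
        simp [rigidityMap, lengthDeriv_apply, hq0, hq1]
      rw [hRq, LinearMap.range_zero, le_bot_iff, LinearMap.range_eq_bot] at hrange
      have h1 := h.lengthDeriv_eq_zero hp (M := Pi.single a ![1, 0])
        (mem_ker_rigidityMap.1 (by simp [hrange])) a b
      simp [lengthDeriv_apply, hab.symm, sub_eq_zero, hp.coord_ne hab] at h1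
    have h0 := hx0 a
    have h1 := hx1 a
    ext i
    fin_cases i <;> simp_all
  have hrank : Module.finrank K (LinearMap.ker (rigidityMap G q)) ≤
      Module.finrank K (LinearMap.range τ) := by
    have h1 := (rigidityMap G p).finrank_range_add_finrank_ker
    have h2 := (rigidityMap G q).finrank_range_add_finrank_ker
    have h3 := Submodule.finrank_mono hrange
    have h4 := h.finrank_ker_rigidityMap_le hp hab
    rw [LinearMap.finrank_range_of_inj hτ, Module.finrank_fin_fun]
    omega
  have hMτ : M ∈ LinearMap.range τ := by
    rw [Submodule.eq_of_le_of_finrank_le hτker hrank]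
    exact mem_ker_rigidityMap.2 hM
  obtain ⟨x, rfl⟩ := hMτ
  exact ⟨x 0, x 1, x 2, fun v => ⟨rfl, rfl⟩⟩

/-! ### Distances between neighbours of the removed vertex. -/

/-- If every functional on the plane restricts to `a`, `b`, `c` as some functional restricts to
`a'`, `b'`, `c'`, then the linear relation between `a`, `b`, `c` also holds between
`a'`, `b'`, `c'`. Together with `d c = d c'` this relates the Gram matrices of `a`, `b` and
`a'`, `b'`. -/
theorem gram_relation {K : Type*} [Field K] {a b c a' b' c' : Fin 2 → K}
    (hdet : a 0 * b 1 - a 1 * b 0 ≠ 0) (hc : d c = d c')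
    (h : ∀ W : Fin 2 → K, ∃ W' : Fin 2 → K, a' ⬝ᵥ W' = a ⬝ᵥ W ∧ b' ⬝ᵥ W' = b ⬝ᵥ W ∧
      c' ⬝ᵥ W' = c ⬝ᵥ W) :
    (c 0 * b 1 - c 1 * b 0) ^ 2 * (a ⬝ᵥ a - a' ⬝ᵥ a') +
      2 * ((c 0 * b 1 - c 1 * b 0) * (a 0 * c 1 - a 1 * c 0)) * (a ⬝ᵥ b - a' ⬝ᵥ b') +
      (a 0 * c 1 - a 1 * c 0) ^ 2 * (b ⬝ᵥ b - b' ⬝ᵥ b') = 0 := by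
  obtain ⟨U, ha, hb, hc₁⟩ := h ![1, 0]
  obtain ⟨W, ha', hb', hc'⟩ := h ![0, 1]
  simp only [dotProduct, Fin.sum_univ_two, Matrix.cons_val_zero, Matrix.cons_val_one,
    mul_one, mul_zero, add_zero, zero_add] at *
  -- By multiplicativity, this determinant times that of `a'`, `b'` is the determinant of `a`, `b`.
  have hN : U 0 * W 1 - U 1 * W 0 ≠ 0 := by
    intro hN
    apply hdet
    rw [← ha, ← hb, ← ha', ← hb']
    linear_combination (a' 0 * b' 1 - a' 1 * b' 0) * hN
  set A := c 0 * b 1 - c 1 * b 0 with hA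
  set B := a 0 * c 1 - a 1 * c 0 with hB
  set δ := a 0 * b 1 - a 1 * b 0 with hδ
  -- Cramer's rule; pairing with `U` and `W` carries the relation over to `a'`, `b'`, `c'`.
  have h0 : δ * c 0 = A * a 0 + B * b 0 := by rw [hA, hB, hδ]; ring
  have h1 : δ * c 1 = A * a 1 + B * b 1 := by rw [hA, hB, hδ]; ring
  have hU : (δ * c' 0 - A * a' 0 - B * b' 0) * U 0 +
      (δ * c' 1 - A * a' 1 - B * b' 1) * U 1 = 0 := by
    linear_combination δ * hc₁ - A * ha - B * hb + h0
  have hW : (δ * c' 0 - A * a' 0 - B * b' 0) * W 0 +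
      (δ * c' 1 - A * a' 1 - B * b' 1) * W 1 = 0 := by
    linear_combination δ * hc' - A * ha' - B * hb' + h1
  have h0' : δ * c' 0 - A * a' 0 - B * b' 0 = 0 := (mul_eq_zero.1 (by
    linear_combination W 1 * hU - U 1 * hW)).resolve_right hN
  have h1' : δ * c' 1 - A * a' 1 - B * b' 1 = 0 := (mul_eq_zero.1 (by
    linear_combination U 0 * hW - W 0 * hU)).resolve_right hN
  simp only [d] at hc
  linear_combination δ ^ 2 * hc - (δ * c 0 + A * a 0 + B * b 0) * h0
    - (δ * c 1 + A * a 1 + B * b 1) * h1 + (δ * c' 0 + A * a' 0 + B * b' 0) * h0'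
    + (δ * c' 1 + A * a' 1 + B * b' 1) * h1'

/-- If removing a vertex from `G` leaves a rigid graph, then the distances between any three of its
neighbours agree in all realisations equivalent to a generic one. -/
theorem Equivalent.d_neighbors_eq {V K : Type*} [Finite V] [Field K] [Algebra ℚ K]
    {G : SimpleGraph V} {p q : V → Fin 2 → K} (hpq : Equivalent G p q) (hp : Generic p)
    {n v₁ v₂ v₃ : V} (h₁₂ : v₁ ≠ v₂) (h₁₃ : v₁ ≠ v₃) (h₂₃ : v₂ ≠ v₃)
    (h₁ : G.Adj n v₁) (h₂ : G.Adj n v₂) (h₃ : G.Adj n v₃)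
    (hrigid : RigidGraph (G.induce {n}ᶜ)) :
    d (p v₁ - p v₂) = d (q v₁ - q v₂) := by
  classical
  have : CharZero K := algebraRat.charZero K
  let p' : ({n}ᶜ : Set V) → Fin 2 → K := fun x => p x.1
  let q' : ({n}ᶜ : Set V) → Fin 2 → K := fun x => q x.1
  have hp' : Generic p' := AlgebraicIndependent.comp hp
    (fun e : ({n}ᶜ : Set V) × Fin 2 => (e.1.1, e.2))
    (Subtype.val_injective.prodMap Function.injective_id)
  have hpq' : Equivalent (G.induce {n}ᶜ) p' q' := fun a b hab => hpq _ _ hab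
  have hmotion (W : Fin 2 → K) : ∃ D : Derivation ℚ K K, (∀ i, D (p n i) = W i) ∧
      (∀ v ≠ n, ∀ i, D (p v i) = 0) ∧
      ∃ s t ω : K, ∀ v ≠ n, D (q v 0) = s - ω * q v 1 ∧ D (q v 1) = t + ω * q v 0 := by
    obtain ⟨D, hD⟩ := hp.exists_derivation (Pi.single n W)
    have hD0 (v : V) (hv : v ≠ n) (i : Fin 2) : D (p v i) = 0 := by simp [hD, hv]
    obtain ⟨s, t, ω, h⟩ := hrigid.exists_infinitesimal_isometry hp' hpq'
      (a := ⟨v₁, h₁.ne'⟩) (b := ⟨v₂, h₂.ne'⟩) (fun h => h₁₂ congr(Subtype.val $h))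
      (M := fun v i => D (q' v i)) fun a b hab => by
        have h := congr(D $(hpq' a b hab))
        rw [derivation_d_sub, derivation_d_sub] at h
        refine (mul_left_cancel₀ two_ne_zero (h.symm.trans ?_))
        simp [lengthDeriv_apply, p', hD0 _ a.2, hD0 _ b.2]
    exact ⟨D, by simp [hD], hD0, s, t, ω, fun v hv => h ⟨v, hv⟩⟩
  have hrel := gram_relation (a := p v₂ - p v₁) (b := p v₃ - p v₁) (c := p n - p v₁)
    (a' := q v₂ - q v₁) (b' := q v₃ - q v₁) (c' := q n - q v₁)
    (hp.det_ne_zero h₁₂ h₁₃ h₂₃) (hpq _ _ h₁) fun W => by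
      obtain ⟨D, hDn, hDp, s, t, ω, hDq⟩ := hmotion W
      -- The velocity of `q n` relative to the infinitesimal isometry carrying the other vertices.
      refine ⟨![D (q n 0) - s + ω * q n 1, D (q n 1) - t - ω * q n 0], ?_⟩
      have key (v : V) (hv : G.Adj n v) :
          (q n 0 - q v 0) * (D (q n 0) - s + ω * q n 1) +
            (q n 1 - q v 1) * (D (q n 1) - t - ω * q n 0) =
          (p n 0 - p v 0) * W 0 + (p n 1 - p v 1) * W 1 := by
        have h := congr(D $(hpq _ _ hv))
        rw [derivation_d_sub, derivation_d_sub] at h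
        have h := mul_left_cancel₀ two_ne_zero h
        simp only [lengthDeriv_apply, hDn, hDp v hv.ne', (hDq v hv.ne').1, (hDq v hv.ne').2,
          sub_zero] at h
        linear_combination -h
      have k₁ := key v₁ h₁
      have k₂ := key v₂ h₂
      have k₃ := key v₃ h₃
      simp only [dotProduct, Fin.sum_univ_two, Matrix.cons_val_zero, Matrix.cons_val_one,
        Pi.sub_apply]
      exact ⟨by linear_combination k₁ - k₂, by linear_combination k₁ - k₃, k₁⟩
  -- Moving `p n` parallel to `p v₂ - p v₁` gives `D A = δ` and `D B = 0`.
  obtain ⟨D, hDn, hDp, s, t, ω, hDq⟩ := hmotion (p v₂ - p v₁)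
  have hDdot (a b : V) (ha : a ≠ n) (hb : b ≠ n) :
      D ((p a - p v₁) ⬝ᵥ (p b - p v₁) - (q a - q v₁) ⬝ᵥ (q b - q v₁)) = 0 := by
    simp [dotProduct, Fin.sum_univ_two, hDp a ha, hDp b hb, hDp v₁ h₁.ne', hDq a ha, hDq b hb,
      hDq v₁ h₁.ne']
    ring
  have hδ := hp.det_ne_zero h₁₂ h₁₃ h₂₃
  have hk₁ := hDdot v₂ v₂ h₂.ne' h₂.ne'
  have hk₂ := hDdot v₂ v₃ h₂.ne' h₃.ne'
  have hk₃ := hDdot v₃ v₃ h₃.ne' h₃.ne'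
  set k₁ := (p v₂ - p v₁) ⬝ᵥ (p v₂ - p v₁) - (q v₂ - q v₁) ⬝ᵥ (q v₂ - q v₁) with hk
  set k₂ := (p v₂ - p v₁) ⬝ᵥ (p v₃ - p v₁) - (q v₂ - q v₁) ⬝ᵥ (q v₃ - q v₁)
  set k₃ := (p v₃ - p v₁) ⬝ᵥ (p v₃ - p v₁) - (q v₃ - q v₁) ⬝ᵥ (q v₃ - q v₁)
  simp only [Pi.sub_apply] at hrel hDn
  set A := (p n 0 - p v₁ 0) * (p v₃ 1 - p v₁ 1) - (p n 1 - p v₁ 1) * (p v₃ 0 - p v₁ 0) with hA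
  set B := (p v₂ 0 - p v₁ 0) * (p n 1 - p v₁ 1) - (p v₂ 1 - p v₁ 1) * (p n 0 - p v₁ 0) with hB
  set δ := (p v₂ 0 - p v₁ 0) * (p v₃ 1 - p v₁ 1) - (p v₂ 1 - p v₁ 1) * (p v₃ 0 - p v₁ 0) with hδ'
  have hDA : D A = δ := by
    simp [hA, hδ', hDn, hDp _ h₁.ne', hDp _ h₃.ne']
    ring
  have hDB : D B = 0 := by
    simp [hB, hDn, hDp _ h₁.ne', hDp _ h₂.ne']
    ring
  -- The derivative of `hrel` is `2 δ (A k₁ + B k₂) = 0`; differentiating again leaves `δ k₁ = 0`.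
  have hlin : A * k₁ + B * k₂ = 0 := by
    have h := congr(D $hrel)
    have hD2 : D (2 : K) = 0 := by simpa using D.map_natCast 2
    simp [hD2, Derivation.leibniz_pow, hk₁, hk₂, hk₃, hDA, hDB] at h
    refine (mul_eq_zero.1 (?_ : (2 * δ) * _ = 0)).resolve_left (mul_ne_zero two_ne_zero hδ)
    linear_combination h
  have hk₁0 : k₁ = 0 := by
    have h := congr(D $hlin)
    simp [hk₁, hk₂, hDA, hDB, hδ] at h
    exact h
  rw [hk] at hk₁0
  simp only [dotProduct, Fin.sum_univ_two, Pi.sub_apply] at hk₁0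
  simp only [d, Pi.sub_apply]
  linear_combination hk₁0

end PlaneFramework

theorem mainTheorem11 {V : Type*} [Finite V] (G : SimpleGraph V) (p : V → Fin 2 → ℂ)
    (hp : PlaneFramework.Generic p)
    (u v v₁ v₂ v₃ vₙ : V)
    (h₁₂ : v₁ ≠ v₂) (h₁₃ : v₁ ≠ v₃) (h₂₃ : v₂ ≠ v₃)
    (hN : G.neighborSet vₙ = {v₁, v₂, v₃})
    (h₁ : v₁ ∈ ({vₙ}ᶜ : Set V)) (h₂ : v₂ ∈ ({vₙ}ᶜ : Set V))
    (hu : u ∈ ({vₙ}ᶜ : Set V)) (hv : v ∈ ({vₙ}ᶜ : Set V))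
    (hrigid : PlaneFramework.RigidGraph (G.induce {vₙ}ᶜ))
    (hlinked : PlaneFramework.GloballyLinked
      (G.induce {vₙ}ᶜ ⊔ SimpleGraph.edge ⟨v₁, h₁⟩ ⟨v₂, h₂⟩)
      (fun x => p x.1) ⟨u, hu⟩ ⟨v, hv⟩) :
    PlaneFramework.GloballyLinked G p u v := by
  intro q hpq
  have hadj (w : V) : G.Adj vₙ w ↔ w ∈ ({v₁, v₂, v₃} : Set V) := by
    rw [← hN, SimpleGraph.mem_neighborSet]
  have hd := hpq.d_neighbors_eq hp h₁₂ h₁₃ h₂₃ ((hadj v₁).2 (by simp)) ((hadj v₂).2 (by simp))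
    ((hadj v₃).2 (by simp)) hrigid
  refine hlinked (fun x => q x.1) fun a b hab => ?_
  rcases hab with hab | hab
  · exact hpq _ _ hab
  · rw [SimpleGraph.edge_adj] at hab
    obtain ⟨⟨rfl, rfl⟩ | ⟨rfl, rfl⟩, -⟩ := hab
    · exact hd
    · simpa [PlaneFramework.d, sub_sq_comm] using hd
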